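/- For integers $k\ge 1$ and $n\ge 0$, let the discrete torus $T_{k,n}$ be the graph with vertex set $\mathbb Z_k^n$ in which $x$ and $y$ are joined by an edge if and only if there is a coordinate $j$ such that $x_j$ and $y_j$ are at cyclic distance exactly $1$ in $\mathbb Z_k$ and $x_i=y_i$ for all $i\neq j$. For $A\subset\mathbb Z_k^n$, let $\partial'A$ be the set of edges of $T_{k,n}$ joining a point of $A$ to a point of $\mathbb Z_k^n\setminus A$. Functions $f,g:\mathbb Z_k^n\to\mathbb R$ are called $\epsilon$-close if $\frac1{k^n}\sum_{x\in\mathbb Z_k^n}|f(x)-g(x)|\le\epsilon$, and $g:\mathbb Z_k^n\to\{0,1\}$ is called an $M$-junta if there is a set $J$ of exactly $M$ coordinates such that $g(x)$ depends only on $(x_j)_{j\in J}$. Then there is an absolute constant $C_1>0$ such that for all integers $k\ge 1$, $n\ge 0$, every $A\subset\mathbb Z_k^n$ and every real $\epsilon>0$, there exist an integer $M \geq 0$ and an $M$-junta $g:\mathbb Z_k^n\to\{0,1\}$ such that the characteristic function $1_A$ is $\epsilon$-close to $g$ and $$M\le\exp\left(\frac{C_1|\partial'A|}{k^{n-1}\epsilon}\right).$$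 -/

import Mathlib

namespace TorusJunta

/-- The cyclic distance `|s - t|'` in `ℤ_k`: the absolute value of the representative of `s - t`
in `(-k/2, k/2]`. -/
def cyclicDist {k : ℕ} (s t : ZMod k) : ℕ := (s - t).valMinAbs.natAbs

theorem cyclicDist_self {k : ℕ} (s : ZMod k) : cyclicDist s s = 0 := by
  simp [cyclicDist]

theorem cyclicDist_comm {k : ℕ} (s t : ZMod k) : cyclicDist s t = cyclicDist t s := by
  unfold cyclicDist
  rw [← neg_sub, ZMod.natAbs_valMinAbs_neg]

/-- The discrete torus `T_{k,n}`: two points of `ℤ_k^n` are adjacent iff they are at cyclic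
distance exactly `1` in some coordinate and agree in all the others. -/
def torus (k n : ℕ) : SimpleGraph (Fin n → ZMod k) where
  Adj x y := ∃ j, cyclicDist (y j) (x j) = 1 ∧ ∀ i, i ≠ j → x i = y i
  symm := ⟨by
    rintro x y ⟨j, hj, h⟩
    exact ⟨j, by rw [cyclicDist_comm]; exact hj, fun i hi => (h i hi).symm⟩⟩
  loopless := ⟨by
    rintro x ⟨j, hj, -⟩
    simp [cyclicDist_self] at hj⟩

/-- The edge-boundary of a vertex set `A`: the set of (unordered) edges of `G` joining a point
of `A` to a point of its complement. -/
def edgeBoundary {V : Type*} (G : SimpleGraph V) (A : Set V) : Set (Sym2 V) :=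
  {e | e ∈ G.edgeSet ∧ ∃ x ∈ A, ∃ y ∈ Aᶜ, e = s(x, y)}

/-- The normalised `L¹`-norm of a real-valued function on `ℤ_k^n`. -/
noncomputable def l1Norm {k n : ℕ} [NeZero k] (f : (Fin n → ZMod k) → ℝ) : ℝ :=
  1 / (k : ℝ) ^ n * ∑ x, |f x|

/-- `f` and `g` are `ε`-close. -/
def IsClose {k n : ℕ} [NeZero k] (ε : ℝ) (f g : (Fin n → ZMod k) → ℝ) : Prop :=
  l1Norm (f - g) ≤ ε

/-- `g` is a `{0,1}`-valued `M`-junta: there is a set `J` of `M` coordinates such that `g x`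
depends only on the values `x j`, `j ∈ J`. -/
def IsBooleanJunta {k n : ℕ} (M : ℕ) (g : (Fin n → ZMod k) → ℝ) : Prop :=
  (∀ x, g x = 0 ∨ g x = 1) ∧ ∃ J : Finset (Fin n), J.card = M ∧ DependsOn g (J : Set (Fin n))

end TorusJunta

/-! The torus is replaced by a Boolean cube. Each coordinate is encoded by `m` bits: they spell an
integer below `2 ^ m`, and this range is cut into `k` nearly equal cells (`decode`). Flipping bit
`i` moves the integer by `2 ^ i`, so it crosses a given cell wall for at most `2 * 2 ^ i` strings
(`card_crossing_le`). The influences of the bits of one block are therefore dominated by a geometric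
series, and the pull-back of `1_A` has total influence at most `4 |∂'A| / k ^ (n - 1)`, whatever the
size of `m` (`sum_influence_decode_le`).

Friedgut's argument then runs on the cube. Fourier weight of high degree is controlled by the total
influence; low-degree weight on sets containing a coordinate of small influence is small by
hypercontractivity (`sum_low_degree_walshCoeff_sq_le`). Hence almost all the weight sits on subsets
of the few influential bits (`exists_junta_walshCoeff`). Enlarging these to whole blocks, averaging
over the other blocks and rounding at `1/2` yields a junta on the torus itself
(`exists_junta_of_walshCoeff`). -/

namespace TorusJunta
open Finset BigOperators

/-! ### Walsh characters and their orthogonality -/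

/-- The Walsh character of the cube `{0,1}^V` indexed by `S`. -/
def walsh {V : Type*} (S : Finset V) (x : V → Fin 2) : ℝ := ∏ i ∈ S, if x i = 0 then 1 else -1

/-- The point `x` with the coordinate `i` flipped. -/
def flip {V : Type*} [DecidableEq V] (i : V) (x : V → Fin 2) : V → Fin 2 :=
  Function.update x i (x i + 1)

theorem flip_involutive {V : Type*} [DecidableEq V] (i : V) : Function.Involutive (flip i) := by
  intro x
  ext j
  by_cases h : j = i
  · subst h
    simp only [flip, Function.update_self]
    generalize x j = a
    fin_cases a <;> rfl
  · simp [flip, h]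

theorem walsh_flip {V : Type*} [DecidableEq V] (S : Finset V) (i : V) (x : V → Fin 2) :
    walsh S (flip i x) = (if i ∈ S then -1 else 1) * walsh S x := by
  have aux : ∀ T : Finset V, i ∉ T → walsh T (flip i x) = walsh T x := by
    intro T hT
    refine prod_congr rfl fun j hj => ?_
    have : j ≠ i := fun h => hT (h ▸ hj)
    simp [flip, this]
  split_ifs with h
  · rw [← insert_erase h, walsh, walsh, prod_insert (notMem_erase i S),
      prod_insert (notMem_erase i S)]
    have := aux _ (notMem_erase i S)
    simp only [walsh] at this
    rw [this, ← mul_assoc]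
    congr 1
    simp only [flip, Function.update_self]
    generalize x i = a
    fin_cases a <;> simp
  · rw [one_mul, aux S h]

theorem walsh_mul_self {V : Type*} (S : Finset V) (x : V → Fin 2) : walsh S x * walsh S x = 1 := by
  rw [walsh, ← prod_mul_distrib]
  refine prod_eq_one fun i _ => ?_
  split_ifs <;> simp

/-- The sum over `S` factors as a product over coordinates, and a coordinate where `x` and `y`
differ contributes the factor `1 - 1`. -/
theorem sum_walsh_apply_mul {V : Type*} [Fintype V] (x y : V → Fin 2) :
    ∑ S, walsh S x * walsh S y = if x = y then 2 ^ Fintype.card V else 0 := by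
  simp only [walsh, ← prod_mul_distrib]
  have h := prod_one_add (R := ℝ) (s := univ)
    (f := fun i : V => (if x i = 0 then (1 : ℝ) else -1) * if y i = 0 then 1 else -1)
  rw [powerset_univ] at h
  rw [← h]
  split_ifs with hxy
  · subst hxy
    have : ∀ i, (1 + (if x i = 0 then (1 : ℝ) else -1) * if x i = 0 then 1 else -1) = 2 := by
      intro i
      split_ifs <;> norm_num
    rw [prod_congr rfl fun i _ => this i]
    simp
  · obtain ⟨i, hi⟩ := Function.ne_iff.mp hxy
    refine prod_eq_zero (mem_univ i) ?_
    generalize x i = a at hi ⊢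
    generalize y i = b at hi ⊢
    fin_cases a <;> fin_cases b <;> simp at hi ⊢

section Cube
variable {V : Type*} [Fintype V] [DecidableEq V]

theorem sum_flip {M : Type*} [AddCommMonoid M] (i : V) (F : (V → Fin 2) → M) :
    ∑ x, F (flip i x) = ∑ x, F x :=
  Equiv.sum_comp (flip_involutive i).toPerm F

theorem sum_walsh_mul_walsh (S T : Finset V) :
    ∑ x, walsh S x * walsh T x = if S = T then 2 ^ Fintype.card V else 0 := by
  split_ifs with h
  · subst h
    simp [walsh_mul_self]
  · obtain ⟨i, hi⟩ : ∃ i, ¬ (i ∈ S ↔ i ∈ T) := by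
      by_contra! H
      exact h (Finset.ext H)
    have h1 := sum_flip i fun x => walsh S x * walsh T x
    have h2 : ∀ x, walsh S (flip i x) * walsh T (flip i x) = -(walsh S x * walsh T x) := by
      intro x
      rw [walsh_flip, walsh_flip]
      by_cases hS : i ∈ S <;> by_cases hT : i ∈ T <;> simp_all
    simp only [h2, sum_neg_distrib] at h1
    linarith

/-! ### Fourier expansion and hypercontractivity -/

/-- The Walsh–Fourier coefficients of a function on the cube. -/
noncomputable def walshCoeff (F : (V → Fin 2) → ℝ) (S : Finset V) : ℝ :=
  (∑ x, F x * walsh S x) / 2 ^ Fintype.card V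

theorem sum_walshCoeff_mul_walsh (F : (V → Fin 2) → ℝ) (x : V → Fin 2) :
    ∑ S, walshCoeff F S * walsh S x = F x := by
  simp only [walshCoeff, div_mul_eq_mul_div, ← sum_div, sum_mul]
  rw [sum_comm]
  simp only [mul_assoc, ← mul_sum, sum_walsh_apply_mul]
  simp

theorem sum_sq_sum_walsh (𝒜 : Finset (Finset V)) (a : Finset V → ℝ) :
    ∑ x, (∑ S ∈ 𝒜, a S * walsh S x) ^ 2 = 2 ^ Fintype.card V * ∑ S ∈ 𝒜, a S ^ 2 := by
  simp only [sq, sum_mul_sum]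
  rw [sum_comm, mul_sum]
  refine sum_congr rfl fun S hS => ?_
  rw [sum_comm]
  have : ∀ T, ∑ x, a S * walsh S x * (a T * walsh T x)
      = if S = T then 2 ^ Fintype.card V * (a S * a T) else 0 := by
    intro T
    have := sum_walsh_mul_walsh S T
    calc _ = (a S * a T) * ∑ x, walsh S x * walsh T x := by
          rw [mul_sum]; exact sum_congr rfl fun x _ => by ring
      _ = _ := by rw [this]; split_ifs <;> ring
  simp [this, hS]

/-- The `(2, 4)`-hypercontractive inequality on the cube. -/
theorem sum_pow_four_sum_powerset_walsh (U : Finset V) (a : Finset V → ℝ) :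
    ∑ x, (∑ S ∈ U.powerset, a S * walsh S x) ^ 4 ≤
      2 ^ Fintype.card V * (∑ S ∈ U.powerset, 3 ^ #S * a S ^ 2) ^ 2 := by
  induction U using Finset.induction_on generalizing a with
  | empty => simp [walsh]; apply le_of_eq; ring
  | insert i U hi ih =>
    set p : (V → Fin 2) → ℝ := fun x => ∑ S ∈ U.powerset, a S * walsh S x with hp
    set q : (V → Fin 2) → ℝ := fun x => ∑ S ∈ U.powerset, a (insert i S) * walsh S x with hq
    set A := ∑ S ∈ U.powerset, 3 ^ #S * a S ^ 2 with hA
    set B := ∑ S ∈ U.powerset, 3 ^ #S * a (insert i S) ^ 2 with hB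
    set N : ℝ := 2 ^ Fintype.card V with hN
    have hiS : ∀ S ∈ U.powerset, i ∉ S := fun S hS h => hi (mem_powerset.mp hS h)
    have ihp : ∑ x, p x ^ 4 ≤ N * A ^ 2 := ih a
    have ihq : ∑ x, q x ^ 4 ≤ N * B ^ 2 := ih fun S => a (insert i S)
    have hA0 : 0 ≤ A := sum_nonneg fun _ _ => by positivity
    have hB0 : 0 ≤ B := sum_nonneg fun _ _ => by positivity
    have hN0 : 0 < N := by positivity
    have hsplit : ∀ x, ∑ S ∈ (insert i U).powerset, a S * walsh S x = p x + walsh {i} x * q x := by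
      intro x
      rw [sum_powerset_insert hi, hq, mul_sum]
      congr 1
      refine sum_congr rfl fun S hS => ?_
      rw [walsh, prod_insert (hiS S hS)]
      simp only [walsh, prod_singleton]
      ring
    have hpf : ∀ x, p (flip i x) = p x := fun x =>
      sum_congr rfl fun S hS => by rw [walsh_flip, if_neg (hiS S hS), one_mul]
    have hqf : ∀ x, q (flip i x) = q x := fun x =>
      sum_congr rfl fun S hS => by rw [walsh_flip, if_neg (hiS S hS), one_mul]
    have hright : ∑ S ∈ (insert i U).powerset, 3 ^ #S * a S ^ 2 = A + 3 * B := by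
      rw [sum_powerset_insert hi, hB, mul_sum]
      congr 1
      refine sum_congr rfl fun S hS => ?_
      rw [card_insert_of_notMem (hiS S hS)]
      ring
    -- Neither `p` nor `q` depends on coordinate `i`, so averaging with the flip at `i` cancels the
    -- odd powers of the character.
    have hleft : ∑ x, (p x + walsh {i} x * q x) ^ 4
        = ∑ x, p x ^ 4 + 6 * ∑ x, p x ^ 2 * q x ^ 2 + ∑ x, q x ^ 4 := by
      have h1 := sum_flip i fun x => (p x + walsh {i} x * q x) ^ 4
      simp only [hpf, hqf, walsh_flip, mem_singleton, if_true] at h1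
      have h2 : ∑ x, (p x + walsh {i} x * q x) ^ 4 + ∑ x, (p x + -1 * walsh {i} x * q x) ^ 4
          = 2 * (∑ x, p x ^ 4 + 6 * ∑ x, p x ^ 2 * q x ^ 2 + ∑ x, q x ^ 4) := by
        rw [mul_sum, ← sum_add_distrib, ← sum_add_distrib, ← sum_add_distrib, mul_sum]
        refine sum_congr rfl fun x _ => ?_
        have hw : walsh {i} x ^ 2 = 1 := by rw [sq, walsh_mul_self]
        have hw4 : walsh {i} x ^ 4 = 1 := by rw [show 4 = 2 * 2 by rfl, pow_mul, hw, one_pow]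
        linear_combination (12 * p x ^ 2 * q x ^ 2) * hw + 2 * q x ^ 4 * hw4
      linarith
    have hcs : ∑ x, p x ^ 2 * q x ^ 2 ≤ N * (A * B) := by
      have h := sum_mul_sq_le_sq_mul_sq univ (fun x => p x ^ 2) fun x => q x ^ 2
      simp only [← pow_mul, Nat.reduceMul] at h
      refine le_of_sq_le_sq (h.trans ?_) (mul_nonneg hN0.le (mul_nonneg hA0 hB0))
      calc _ ≤ (N * A ^ 2) * (N * B ^ 2) := by
            refine mul_le_mul ihp ihq (sum_nonneg fun _ _ => by positivity) (by positivity)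
        _ = _ := by ring
    simp only [hsplit, hright, hleft]
    -- The bound `A² + 6AB + B²` falls short of `(A + 3B)²` by `8B²`.
    nlinarith [mul_nonneg hN0.le (mul_nonneg hB0 hB0)]

theorem sum_pow_four_sum_walsh (𝒜 : Finset (Finset V)) (a : Finset V → ℝ) :
    ∑ x, (∑ S ∈ 𝒜, a S * walsh S x) ^ 4 ≤
      2 ^ Fintype.card V * (∑ S ∈ 𝒜, 3 ^ #S * a S ^ 2) ^ 2 := by
  have h := sum_pow_four_sum_powerset_walsh univ fun S => if S ∈ 𝒜 then a S else 0
  simpa [powerset_univ, ite_mul, ite_pow, mul_ite] using h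

/-! ### Influences and Friedgut's theorem on the cube -/

/-- The points at which flipping the coordinate `i` changes the value of `F`. -/
noncomputable def pivotal (F : (V → Fin 2) → ℝ) (i : V) : Finset (V → Fin 2) := {x | F x ≠ F (flip i x)}

/-- The (Boolean) influence of the coordinate `i` on `F`. -/
noncomputable def influence (F : (V → Fin 2) → ℝ) (i : V) : ℝ :=
  #(pivotal F i) / 2 ^ Fintype.card V

theorem influence_nonneg (F : (V → Fin 2) → ℝ) (i : V) : 0 ≤ influence F i := by
  unfold influence; positivity

/-- The character is odd under the flip at `i`, so it sees only the odd part of `F`, which is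
supported on the pivotal points. -/
theorem walshCoeff_eq_of_mem (F : (V → Fin 2) → ℝ) {i : V} {S : Finset V} (hi : i ∈ S) :
    walshCoeff F S = (∑ x, (F x - F (flip i x)) / 2 * walsh S x) / 2 ^ Fintype.card V := by
  have h := sum_flip i fun x => F x * walsh S x
  simp only [walsh_flip, if_pos hi] at h
  rw [walshCoeff]
  congr 1
  have h2 : ∑ x, (F x - F (flip i x)) / 2 * walsh S x =
      (∑ x, F x * walsh S x + ∑ x, F (flip i x) * (-1 * walsh S x)) / 2 := by
    rw [← sum_add_distrib, sum_div]
    exact sum_congr rfl fun x _ => by ring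
  rw [h2, h]; ring

theorem sq_half_sub_flip {F : (V → Fin 2) → ℝ} (hF : ∀ x, F x = 0 ∨ F x = 1) (i : V)
    (x : V → Fin 2) :
    ((F x - F (flip i x)) / 2) ^ 2 = if x ∈ pivotal F i then 1 / 4 else 0 := by
  simp only [pivotal, mem_filter, mem_univ, true_and]
  rcases hF x with h | h <;> rcases hF (flip i x) with h' | h' <;> norm_num [h, h']

theorem sum_sq_half_sub_flip {F : (V → Fin 2) → ℝ} (hF : ∀ x, F x = 0 ∨ F x = 1) (i : V) :
    ∑ x, ((F x - F (flip i x)) / 2) ^ 2 = (#(pivotal F i) : ℝ) / 4 := by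
  simp only [sq_half_sub_flip hF]
  simp [div_eq_mul_inv]

theorem sum_mem_walshCoeff_sq {F : (V → Fin 2) → ℝ} (hF : ∀ x, F x = 0 ∨ F x = 1) (i : V) :
    ∑ S with i ∈ S, walshCoeff F S ^ 2 = influence F i / 4 := by
  have h : ∀ x, (F x - F (flip i x)) / 2
      = ∑ S with i ∈ S, walshCoeff F S * walsh S x := by
    intro x
    rw [← sum_walshCoeff_mul_walsh F x, ← sum_walshCoeff_mul_walsh F (flip i x),
      ← sum_sub_distrib, sum_div, sum_filter]
    refine sum_congr rfl fun S _ => ?_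
    rw [walsh_flip]
    split_ifs <;> ring
  have h1 := sum_sq_half_sub_flip hF i
  simp only [h, sum_sq_sum_walsh] at h1
  rw [influence, div_right_comm, ← h1]
  field_simp

theorem sum_card_mul_walshCoeff_sq {F : (V → Fin 2) → ℝ} (hF : ∀ x, F x = 0 ∨ F x = 1) :
    ∑ S, #S * walshCoeff F S ^ 2 = (∑ i, influence F i) / 4 := by
  rw [sum_div]
  simp only [← sum_mem_walshCoeff_sq hF, sum_filter]
  rw [sum_comm]
  simp

/-- The weight `W` is the inner product of the odd part of `F` with its low-degree projection `p`.
Cauchy–Schwarz on the pivotal set, used twice, brings in the fourth moment of `p`, which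
hypercontractivity bounds by `(3 ^ d * W) ^ 2`. Small support thus gains a power: `W ^ 2 ≤ P ^ 3 * 9
^ d / 16`, where `P` is the influence. -/
theorem sum_low_degree_walshCoeff_sq_le {F : (V → Fin 2) → ℝ} (hF : ∀ x, F x = 0 ∨ F x = 1)
    (i : V) (d : ℕ) {σ : ℝ} (hσ : 0 ≤ σ) (hi : influence F i ≤ σ ^ 2) :
    ∑ S with i ∈ S ∧ #S ≤ d, walshCoeff F S ^ 2 ≤ 3 ^ d * σ * influence F i / 4 := by
  set 𝒜 : Finset (Finset V) := {S | i ∈ S ∧ #S ≤ d} with h𝒜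
  set W := ∑ S ∈ 𝒜, walshCoeff F S ^ 2 with hW
  set N : ℝ := 2 ^ Fintype.card V with hN
  set p : (V → Fin 2) → ℝ := fun x => ∑ S ∈ 𝒜, walshCoeff F S * walsh S x with hp
  set b : ℝ := (#(pivotal F i) : ℝ) with hb
  have hN0 : 0 < N := by positivity
  have hW0 : 0 ≤ W := sum_nonneg fun _ _ => by positivity
  have hb0 : 0 ≤ b := by positivity
  have h1 : N * W = ∑ x, (F x - F (flip i x)) / 2 * if x ∈ pivotal F i then p x else 0 := by
    have : ∀ x, ((F x - F (flip i x)) / 2 * if x ∈ pivotal F i then p x else 0)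
        = (F x - F (flip i x)) / 2 * p x := by
      intro x
      split_ifs with h
      · rfl
      · simp only [pivotal, mem_filter, mem_univ, true_and, not_not] at h
        simp [h]
    simp only [this]
    simp only [hp, mul_sum]
    rw [sum_comm, hW, mul_sum]
    refine sum_congr rfl fun S hS => ?_
    have hiS : i ∈ S := (mem_filter.mp hS).2.1
    have : ∑ x, (F x - F (flip i x)) / 2 * (walshCoeff F S * walsh S x)
        = walshCoeff F S * (N * walshCoeff F S) := by
      conv_rhs => rw [walshCoeff_eq_of_mem F hiS, ← hN]
      rw [mul_div_cancel₀ _ hN0.ne', mul_sum, walshCoeff_eq_of_mem F hiS]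
      exact sum_congr rfl fun x _ => by ring
    rw [this]; ring
  have h2 : ∑ x, p x ^ 4 ≤ N * (3 ^ d * W) ^ 2 := by
    refine (sum_pow_four_sum_walsh 𝒜 (walshCoeff F)).trans ?_
    gcongr
    rw [hW, mul_sum]
    refine sum_le_sum fun S hS => ?_
    have : #S ≤ d := (mem_filter.mp hS).2.2
    gcongr
    norm_num
  have h3 : (∑ x, if x ∈ pivotal F i then p x ^ 2 else 0) ^ 2 ≤ b * ∑ x, p x ^ 4 := by
    have h := sum_mul_sq_le_sq_mul_sq univ (fun x => if x ∈ pivotal F i then (1 : ℝ) else 0)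
      fun x => p x ^ 2
    simp only [ite_mul, one_mul, zero_mul, ite_pow, one_pow, ← pow_mul] at h
    simpa [hb] using h
  have h4 : (N * W) ^ 2 ≤ b / 4 * ∑ x, if x ∈ pivotal F i then p x ^ 2 else 0 := by
    rw [h1, hb, ← sum_sq_half_sub_flip hF]
    refine (sum_mul_sq_le_sq_mul_sq univ _ _).trans_eq ?_
    simp [ite_pow]
  have h5 : ((N * W) ^ 2) ^ 2 ≤ (b / 4) ^ 2 * (b * (N * (3 ^ d * W) ^ 2)) := by
    calc _ ≤ (b / 4 * ∑ x, if x ∈ pivotal F i then p x ^ 2 else 0) ^ 2 := by gcongr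
      _ = (b / 4) ^ 2 * (∑ x, if x ∈ pivotal F i then p x ^ 2 else 0) ^ 2 := by ring
      _ ≤ (b / 4) ^ 2 * (b * ∑ x, p x ^ 4) := by gcongr
      _ ≤ _ := by gcongr
  have hbP : b = N * influence F i := by rw [influence, ← hN, ← hb]; field_simp
  set P := influence F i with hPdef
  have hP0 : 0 ≤ P := influence_nonneg F i
  -- `W ^ 2` occurs on both sides of `h5`; cancelling it needs `W ≠ 0`.
  rcases hW0.eq_or_lt with hW' | hW'
  · rw [← hW']; positivity
  have h6 : W ^ 2 ≤ P ^ 3 * (3 ^ d) ^ 2 / 16 := by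
    rw [hbP] at h5
    have : N ^ 4 * W ^ 2 * W ^ 2 ≤ N ^ 4 * W ^ 2 * (P ^ 3 * (3 ^ d) ^ 2 / 16) := by
      calc _ = ((N * W) ^ 2) ^ 2 := by ring
        _ ≤ _ := h5
        _ = _ := by ring
    exact le_of_mul_le_mul_left this (by positivity)
  refine le_of_sq_le_sq (h6.trans ?_) (by positivity)
  calc P ^ 3 * (3 ^ d) ^ 2 / 16 = P * (P ^ 2 * (3 ^ d) ^ 2 / 16) := by ring
    _ ≤ σ ^ 2 * (P ^ 2 * (3 ^ d) ^ 2 / 16) := by gcongr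
    _ = _ := by ring

/-- Poincaré's inequality on the cube. -/
theorem sum_not_subset_empty_walshCoeff_sq_le {F : (V → Fin 2) → ℝ}
    (hF : ∀ x, F x = 0 ∨ F x = 1) :
    ∑ S with ¬ S ⊆ ∅, walshCoeff F S ^ 2 ≤ (∑ i, influence F i) / 4 := by
  rw [← sum_card_mul_walshCoeff_sq hF, sum_filter]
  refine sum_le_sum fun S _ => ?_
  by_cases h : S ⊆ ∅
  · simp only [h, not_true_eq_false, if_false]
    positivity
  · rw [if_pos h]
    have : 1 ≤ #S := by
      rw [one_le_card, nonempty_iff_ne_empty]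
      exact fun h' => h (by rw [h'])
    have : (1 : ℝ) ≤ #S := by exact_mod_cast this
    nlinarith [sq_nonneg (walshCoeff F S)]

/-- Friedgut's junta theorem on the cube, in Fourier form. -/
theorem exists_junta_walshCoeff {F : (V → Fin 2) → ℝ} (hF : ∀ x, F x = 0 ∨ F x = 1) {L δ : ℝ}
    (hL : 0 < L) (hδ : 0 < δ) (d : ℕ) (hI : ∑ i, influence F i ≤ L) (hd : L ≤ 2 * δ * (d + 1)) :
    ∃ J : Finset V, (#J : ℝ) ≤ L ^ 3 * 9 ^ d / (4 * δ ^ 2) ∧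
      ∑ S with ¬ S ⊆ J, walshCoeff F S ^ 2 ≤ δ := by
  -- Chosen so that the low-degree total `3 ^ d * σ * L / 4` is exactly `δ / 2`.
  set σ : ℝ := 2 * δ / (3 ^ d * L) with hσ
  have hσ0 : 0 < σ := by positivity
  refine ⟨({i | σ ^ 2 < influence F i} : Finset V), ?_, ?_⟩
  · have h1 : (#({i | σ ^ 2 < influence F i} : Finset V) : ℝ) * σ ^ 2 ≤ L := by
      refine le_trans ?_ hI
      rw [← nsmul_eq_mul]
      refine (card_nsmul_le_sum _ (influence F) _ fun i hi => (mem_filter.mp hi).2.le).trans ?_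
      exact sum_le_sum_of_subset_of_nonneg (subset_univ _) fun i _ _ => influence_nonneg F i
    rw [← le_div_iff₀ (by positivity)] at h1
    refine h1.trans_eq ?_
    rw [hσ, show (9 : ℝ) = 3 ^ 2 by norm_num, ← pow_mul, mul_comm 2 d, pow_mul]
    field_simp
    ring
  · set J : Finset V := {i | σ ^ 2 < influence F i} with hJ
    -- A set not inside `J` either has more than `d` elements, paid for by Markov's inequality, or
    -- is counted at some `i ∈ S` outside `J`.
    have key : ∀ S : Finset V, (if ¬ S ⊆ J then walshCoeff F S ^ 2 else 0) ≤
        (#S * walshCoeff F S ^ 2) / (d + 1) +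
          ∑ i, if i ∉ J then (if i ∈ S ∧ #S ≤ d then walshCoeff F S ^ 2 else 0) else 0 := by
      intro S
      have hpos : ∀ i ∈ univ, (0 : ℝ) ≤
          if i ∉ J then (if i ∈ S ∧ #S ≤ d then walshCoeff F S ^ 2 else 0) else 0 := by
        intro i _
        split_ifs <;> positivity
      have hpos' : 0 ≤ (#S * walshCoeff F S ^ 2) / ((d : ℝ) + 1) := by positivity
      by_cases h : S ⊆ J
      · simp only [h, not_true_eq_false, if_false]
        exact add_nonneg hpos' (sum_nonneg hpos)
      · rw [if_pos h]
        obtain ⟨i, hiS, hiJ⟩ := not_subset.mp h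
        by_cases hSd : #S ≤ d
        · have := single_le_sum hpos (mem_univ i)
          rw [if_pos hiJ, if_pos ⟨hiS, hSd⟩] at this
          linarith
        · have h1 : (d : ℝ) + 1 ≤ #S := by exact_mod_cast not_le.mp hSd
          have h2 : walshCoeff F S ^ 2 ≤ (#S * walshCoeff F S ^ 2) / ((d : ℝ) + 1) := by
            rw [le_div_iff₀ (by positivity), mul_comm]
            gcongr
          linarith [sum_nonneg hpos]
    rw [sum_filter]
    refine (sum_le_sum fun S _ => key S).trans ?_
    rw [sum_add_distrib, ← sum_div, sum_card_mul_walshCoeff_sq hF, sum_comm]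
    have h1 : (∑ i, influence F i) / 4 / ((d : ℝ) + 1) ≤ δ / 2 := by
      rw [div_div, div_le_iff₀ (by positivity)]
      linarith
    have h2 : (∑ i, ∑ S, if i ∉ J then
        (if i ∈ S ∧ #S ≤ d then walshCoeff F S ^ 2 else 0) else 0) ≤ δ / 2 := by
      calc _ ≤ ∑ i, 3 ^ d * σ * influence F i / 4 := by
            refine sum_le_sum fun i _ => ?_
            by_cases hi : i ∈ J
            · simp only [hi, not_true_eq_false, if_false, sum_const_zero]
              have := influence_nonneg F i
              positivity
            · simp only [hi, not_false_eq_true, if_true]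
              rw [← sum_filter]
              exact sum_low_degree_walshCoeff_sq_le hF i d hσ0.le
                (not_lt.mp fun h => hi (mem_filter.mpr ⟨mem_univ i, h⟩))
        _ = 3 ^ d * σ / 4 * ∑ i, influence F i := by
            rw [mul_sum]; exact sum_congr rfl fun i _ => by ring
        _ ≤ 3 ^ d * σ / 4 * L := by gcongr
        _ = δ / 2 := by rw [hσ]; field_simp; ring
    linarith

/-! ### Averaging out coordinates -/

/-- The average of `F` over the coordinates outside `K`. -/
noncomputable def averageOff (K : Finset V) (F : (V → Fin 2) → ℝ) (u : V → Fin 2) : ℝ :=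
  (∑ w, F (K.piecewise u w)) / 2 ^ Fintype.card V

theorem sum_walsh_piecewise (K S : Finset V) (u : V → Fin 2) :
    ∑ w, walsh S (K.piecewise u w) = if S ⊆ K then 2 ^ Fintype.card V * walsh S u else 0 := by
  split_ifs with h
  · have : ∀ w, walsh S (K.piecewise u w) = walsh S u := fun w =>
      prod_congr rfl fun i hi => by rw [piecewise_eq_of_mem _ _ _ (h hi)]
    simp [this]
  · obtain ⟨i, hiS, hiK⟩ := not_subset.mp h
    have h1 := sum_flip i fun w => walsh S (K.piecewise u w)
    have h2 : ∀ w, K.piecewise u (flip i w) = flip i (K.piecewise u w) := by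
      intro w
      ext j
      by_cases hj : j = i
      · subst hj
        simp [flip, hiK]
      · by_cases hjK : j ∈ K <;> simp [flip, hj, hjK]
    simp only [h2, walsh_flip, if_pos hiS, neg_mul, one_mul, sum_neg_distrib] at h1
    linarith

/-- Averaging kills exactly the characters not supported in `K` and fixes the others; Parseval then
applies. -/
theorem sum_sq_sub_averageOff (K : Finset V) (F : (V → Fin 2) → ℝ) :
    ∑ u, (F u - averageOff K F u) ^ 2
      = 2 ^ Fintype.card V * ∑ S with ¬ S ⊆ K, walshCoeff F S ^ 2 := by
  have h : ∀ u, F u - averageOff K F u = ∑ S with ¬ S ⊆ K, walshCoeff F S * walsh S u := by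
    intro u
    have h1 : averageOff K F u = ∑ S, if S ⊆ K then walshCoeff F S * walsh S u else 0 := by
      have : ∑ w, F (K.piecewise u w) = ∑ S, walshCoeff F S * ∑ w, walsh S (K.piecewise u w) := by
        simp only [mul_sum]
        rw [sum_comm]
        exact sum_congr rfl fun w _ => (sum_walshCoeff_mul_walsh F _).symm
      rw [averageOff, this, sum_div]
      refine sum_congr rfl fun S _ => ?_
      rw [sum_walsh_piecewise]
      split_ifs
      · field_simp
      · simp
    rw [h1, sum_filter]
    conv_lhs => rw [← sum_walshCoeff_mul_walsh F u]
    rw [← sum_sub_distrib]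
    refine sum_congr rfl fun S _ => ?_
    split_ifs <;> simp
  simp only [h, sum_sq_sum_walsh]

end Cube

/-! ### Binary digits and cells -/

/-- The integer with binary digits `b`. -/
def binary {m : ℕ} (b : Fin m → Fin 2) : ℕ := (finFunctionFinEquiv b : Fin (2 ^ m))

theorem binary_lt {m : ℕ} (b : Fin m → Fin 2) : binary b < 2 ^ m := (finFunctionFinEquiv b).isLt

theorem binary_injective {m : ℕ} : Function.Injective (binary (m := m)) :=
  Fin.val_injective.comp finFunctionFinEquiv.injective

theorem binary_flip {m : ℕ} (i : Fin m) (b : Fin m → Fin 2) :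
    binary (flip i b) = binary b + 2 ^ (i : ℕ) ∨ binary b = binary (flip i b) + 2 ^ (i : ℕ) := by
  simp only [binary, finFunctionFinEquiv_apply]
  rw [← add_sum_erase _ _ (mem_univ i), ← add_sum_erase _ (fun j => (b j : ℕ) * _) (mem_univ i)]
  have : ∑ x ∈ univ.erase i, ((flip i b x : Fin 2) : ℕ) * 2 ^ (x : ℕ)
      = ∑ x ∈ univ.erase i, ((b x : Fin 2) : ℕ) * 2 ^ (x : ℕ) :=
    sum_congr rfl fun j hj => by simp [flip, ne_of_mem_erase hj]
  rw [this]
  simp only [flip, Function.update_self]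
  generalize b i = a
  fin_cases a <;> simp <;> omega

/-- The index of the cell of `{0, …, 2 ^ m - 1}`, cut into `k` consecutive almost equal cells,
that contains the integer with binary digits `b`. -/
def cell (k : ℕ) {m : ℕ} (b : Fin m → Fin 2) : ℕ := k * binary b / 2 ^ m

theorem cell_lt {k m : ℕ} [NeZero k] (b : Fin m → Fin 2) : cell k b < k := by
  rw [cell, Nat.div_lt_iff_lt_mul (by positivity)]
  exact Nat.mul_lt_mul_of_pos_left (binary_lt b) (NeZero.pos k)

theorem cell_mono {k m : ℕ} {b c : Fin m → Fin 2} (h : binary b ≤ binary c) :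
    cell k b ≤ cell k c := Nat.div_le_div_right (Nat.mul_le_mul_left k h)

theorem card_cell_mem_Icc (k m : ℕ) [NeZero k] {t : ℕ} (ht : t < k) :
    (2 : ℝ) ^ m / k - 1 ≤ #{b : Fin m → Fin 2 | cell k b = t} ∧
      (#{b : Fin m → Fin 2 | cell k b = t} : ℝ) ≤ 2 ^ m / k + 1 := by
  have hk : 0 < k := NeZero.pos k
  have hkR : (0 : ℝ) < k := by exact_mod_cast hk
  set N := 2 ^ m with hN
  have hN0 : 0 < N := by positivity
  -- `a` and `b` are the ceilings of `t N / k` and `(t + 1) N / k`: cell `t` is the integer interval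
  -- `[a, b)`.
  obtain ⟨a, ha⟩ : ∃ a, a = (t * N + (k - 1)) / k := ⟨_, rfl⟩
  obtain ⟨b, hb⟩ : ∃ b, b = ((t + 1) * N + (k - 1)) / k := ⟨_, rfl⟩
  have hmem : ∀ s u : ℕ, (s + (k - 1)) / k ≤ u ↔ s ≤ k * u := by
    intro s u
    rw [Nat.div_le_iff_le_mul_add_pred hk, mul_comm]
    omega
  have hcard : #{b : Fin m → Fin 2 | cell k b = t} = #(Ico a b) := by
    refine card_bij (fun b _ => binary b) ?_ (fun _ _ _ _ h => binary_injective h) ?_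
    · intro c hc
      have hc := (mem_filter.mp hc).2
      rw [cell, Nat.div_eq_iff hN0] at hc
      rw [mem_Ico, ha, hb, hmem, ← not_le, hmem]
      constructor
      · linarith
      · have := hc.2
        rw [add_mul]
        omega
    · intro u hu
      rw [mem_Ico, ha, hb, hmem, ← not_le, hmem] at hu
      have huN : u < N := by
        have h1 : k * u < (t + 1) * N := not_le.mp hu.2
        have h2 : (t + 1) * N ≤ k * N := Nat.mul_le_mul_right N ht
        exact lt_of_mul_lt_mul_left (h1.trans_le h2) (Nat.zero_le k)
      refine ⟨finFunctionFinEquiv.symm ⟨u, huN⟩, ?_, by simp [binary]⟩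
      refine mem_filter.mpr ⟨mem_univ _, ?_⟩
      rw [cell, binary, Equiv.apply_symm_apply]
      change k * u / N = t
      rw [Nat.div_eq_iff hN0]
      constructor
      · linarith
      · have := not_le.mp hu.2
        rw [add_mul] at this
        omega
  have ha1 : t * N ≤ k * a := (hmem _ _).mp ha.ge
  have hb1 : (t + 1) * N ≤ k * b := (hmem _ _).mp hb.ge
  have ha2 : k * a ≤ t * N + (k - 1) := ha ▸ Nat.mul_div_le _ _
  have hb2 : k * b ≤ (t + 1) * N + (k - 1) := hb ▸ Nat.mul_div_le _ _
  have hab : a ≤ b := by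
    rw [ha, hb]
    gcongr
    omega
  have ha2' : k * a ≤ t * N + k := by omega
  have hb2' : k * b ≤ (t + 1) * N + k := by omega
  rw [hcard, Nat.card_Ico, Nat.cast_sub hab]
  have e1 : (t : ℝ) * N ≤ k * a := by exact_mod_cast ha1
  have e2 : ((t : ℝ) + 1) * N ≤ k * b := by exact_mod_cast hb1
  have e3 : (k : ℝ) * a ≤ t * N + k := by exact_mod_cast ha2'
  have e4 : (k : ℝ) * b ≤ (t + 1) * N + k := by exact_mod_cast hb2'
  have hNR : (2 : ℝ) ^ m = N := by simp [hN]
  rw [hNR]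
  constructor
  · rw [sub_le_iff_le_add, div_le_iff₀ hkR]
    nlinarith
  · rw [← sub_le_iff_le_add, le_div_iff₀ hkR]
    nlinarith

/-- The digit strings whose cell passes the boundary between `t` and `t + 1` when the digit `i` is
flipped. -/
def crossing (k : ℕ) {m : ℕ} (i : Fin m) (t : ℕ) : Finset (Fin m → Fin 2) :=
  {b | ¬(cell k b ≤ t ↔ cell k (flip i b) ≤ t)}

/-- Let `b₀` be the least upward-crossing string. Its flip already lies beyond the wall, so by
monotonicity of cells all upward-crossing strings lie in a window of length `2 ^ i`. Downward
crossings are their flips. -/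
theorem card_crossing_le (k : ℕ) {m : ℕ} (i : Fin m) (t : ℕ) :
    #(crossing k i t) ≤ 2 * 2 ^ (i : ℕ) := by
  set U : Finset (Fin m → Fin 2) := {b | cell k b ≤ t ∧ t < cell k (flip i b)} with hU
  have hUcard : #U ≤ 2 ^ (i : ℕ) := by
    rcases U.eq_empty_or_nonempty with h | h
    · simp [h]
    · obtain ⟨b₀, hb₀, hmin⟩ := exists_min_image U binary h
      have hflip : binary (flip i b₀) = binary b₀ + 2 ^ (i : ℕ) := by
        rcases binary_flip i b₀ with h' | h'
        · exact h'
        · have h1 : cell k (flip i b₀) ≤ cell k b₀ := cell_mono (by rw [h']; exact Nat.le_add_right _ _)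
          have h2 := (mem_filter.mp hb₀).2
          omega
      have : #U ≤ #(Ico (binary b₀) (binary b₀ + 2 ^ (i : ℕ))) := by
        refine card_le_card_of_injOn binary (fun b hb => ?_) binary_injective.injOn
        rw [coe_Ico, Set.mem_Ico]
        refine ⟨hmin b hb, ?_⟩
        by_contra! hlt
        rw [← hflip] at hlt
        have h1 := cell_mono (k := k) hlt
        have h2 := (mem_filter.mp hb₀).2
        have h3 := (mem_filter.mp hb).2
        omega
      simpa using this
  have hsub : crossing k i t ⊆ U ∪ U.image (flip i) := by
    intro b hb
    have hb' := (mem_filter.mp hb).2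
    rw [mem_union, mem_image]
    by_cases h : cell k b ≤ t
    · left
      simp only [hU, mem_filter, mem_univ, true_and]
      exact ⟨h, not_le.mp fun h' => hb' ⟨fun _ => h', fun _ => h⟩⟩
    · right
      refine ⟨flip i b, ?_, flip_involutive i b⟩
      simp only [hU, mem_filter, mem_univ, true_and, flip_involutive i b]
      refine ⟨?_, not_le.mp h⟩
      by_contra h'
      exact hb' ⟨fun h'' => absurd h'' h, fun h'' => absurd h'' h'⟩
  calc _ ≤ #(U ∪ U.image (flip i)) := card_le_card hsub
    _ ≤ #U + #(U.image (flip i)) := card_union_le _ _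
    _ ≤ #U + #U := Nat.add_le_add_left card_image_le _
    _ ≤ _ := by omega

theorem exists_ne_succ {α : Type*} (h : ℕ → α) {a b : ℕ} (hab : a ≤ b) (hne : h a ≠ h b) :
    ∃ t, a ≤ t ∧ t < b ∧ h t ≠ h (t + 1) := by
  by_contra! H
  apply hne
  induction b, hab using Nat.le_induction with
  | base => rfl
  | succ c hac ih =>
    have hc : h a = h c := by
      by_contra hne'
      exact hne' (ih hne' fun t h1 h2 => H t h1 (by omega))
    rw [hc, H c hac (by omega)]

/-! ### Pulling functions back from the torus to the cube -/

/-- The point of `ℤ_k^n` whose `l`-th coordinate is the cell of the `l`-th block of bits of `u`. -/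
def decode (k : ℕ) {n m : ℕ} (u : Fin n × Fin m → Fin 2) (l : Fin n) : ZMod k :=
  (cell k fun i => u (l, i) : ℕ)

theorem decode_eq_iff {k n m : ℕ} [NeZero k] (u : Fin n × Fin m → Fin 2) (l : Fin n) (s : ZMod k) :
    decode k u l = s ↔ cell k (fun i => u (l, i)) = s.val := by
  constructor
  · rintro rfl
    rw [decode, ZMod.val_cast_of_lt (cell_lt _)]
  · intro h
    rw [decode, h, ZMod.natCast_zmod_val]

theorem block_flip {n m : ℕ} (u : Fin n × Fin m → Fin 2) (j l : Fin n) (i : Fin m) :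
    (fun i' => flip (j, i) u (l, i')) =
      if l = j then flip i (fun i' => u (l, i')) else fun i' => u (l, i') := by
  funext i'
  by_cases hl : l = j
  · subst hl
    by_cases hi : i' = i
    · subst hi
      simp [flip]
    · simp [flip, hi]
  · simp [flip, hl]

theorem decode_flip (k : ℕ) {n m : ℕ} (u : Fin n × Fin m → Fin 2) (j : Fin n) (i : Fin m) :
    decode k (flip (j, i) u) =
      Function.update (decode k u) j (cell k (flip i fun i' => u (j, i')) : ℕ) := by
  funext l
  by_cases hl : l = j
  · subst hl
    simp [decode, block_flip]
  · simp [decode, block_flip, hl]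

/-- The number of bit strings all of whose blocks satisfy given constraints. -/
theorem card_blocks {n m : ℕ} (T : Fin n → Finset (Fin m → Fin 2)) :
    #{u : Fin n × Fin m → Fin 2 | ∀ l, (fun i => u (l, i)) ∈ T l} = ∏ l, #(T l) := by
  rw [← Fintype.card_piFinset]
  refine card_equiv (Equiv.curry (Fin n) (Fin m) (Fin 2)) fun u => ?_
  simp only [mem_filter, mem_univ, true_and, Fintype.mem_piFinset]
  rfl

/-- The points `x` such that the step from `x` to `x + e_j` does not wrap around and changes the
value of `G`. -/
noncomputable def jumps {k n : ℕ} [NeZero k] (G : (Fin n → ZMod k) → ℝ) (j : Fin n) :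
    Finset (Fin n → ZMod k) :=
  {x | (x j).val + 1 < k ∧ G x ≠ G (Function.update x j (x j + 1))}

/-- Flipping a bit moves one coordinate between two cells; walking between them through consecutive
representatives, without wrapping, the value of `G` must change at some wall, which the flip
crosses. -/
theorem exists_jump {k n m : ℕ} [NeZero k] (G : (Fin n → ZMod k) → ℝ) (j : Fin n) (i : Fin m)
    {u : Fin n × Fin m → Fin 2} (hu : u ∈ pivotal (fun u => G (decode k u)) (j, i)) :
    ∃ x ∈ jumps G j, (fun i' => u (j, i')) ∈ crossing k i (x j).val ∧
      ∀ l, l ≠ j → decode k u l = x l := by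
  have hu : G (decode k u) ≠ G (decode k (flip (j, i) u)) := (mem_filter.mp hu).2
  rw [decode_flip] at hu
  set c := cell k (fun i' => u (j, i')) with hc
  set c' := cell k (flip i fun i' => u (j, i')) with hc'
  have hck : c < k := cell_lt _
  have hck' : c' < k := cell_lt _
  set h : ℕ → ℝ := fun t => G (Function.update (decode k u) j (t : ℕ)) with hh
  have h0 : G (decode k u) = h c := by
    simp only [hh]
    congr 1
    exact (Function.update_eq_self j _).symm
  have hne : h c ≠ h c' := by rw [← h0]; exact hu
  obtain ⟨t, htk, ht, hcr⟩ : ∃ t, t + 1 < k ∧ h t ≠ h (t + 1) ∧ ¬ (c ≤ t ↔ c' ≤ t) := by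
    rcases le_total c c' with hle | hle
    · obtain ⟨t, h1, h2, h3⟩ := exists_ne_succ h hle hne
      exact ⟨t, by omega, h3, by omega⟩
    · obtain ⟨t, h1, h2, h3⟩ := exists_ne_succ h hle hne.symm
      exact ⟨t, by omega, h3, by omega⟩
  have hval : ((t : ℕ) : ZMod k).val = t := ZMod.val_cast_of_lt (by omega)
  refine ⟨Function.update (decode k u) j (t : ℕ), ?_, ?_, ?_⟩
  · simp only [jumps, mem_filter, mem_univ, true_and, Function.update_self, hval,
      Function.update_idem]
    refine ⟨htk, ?_⟩
    simp only [hh] at ht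
    push_cast at ht
    exact ht
  · simp only [crossing, mem_filter, mem_univ, true_and, Function.update_self, hval]
    exact hcr
  · intro l hl
    simp [hl]

/-- For `m` large, the rounding errors in the cell sizes, multiplied over all `n` blocks, cost at
most a factor `2`. -/
theorem one_add_div_pow_le_two {k n m : ℕ} [NeZero k] (hm : 2 * n * k ≤ 2 ^ m) :
    1 / 2 ≤ (1 - (k : ℝ) / 2 ^ m) ^ n ∧ (1 + (k : ℝ) / 2 ^ m) ^ n ≤ 2 := by
  set r : ℝ := (k : ℝ) / 2 ^ m with hr
  have hr0 : 0 ≤ r := by positivity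
  rcases Nat.eq_zero_or_pos n with hn | hn
  · subst hn; norm_num
  have hnr : n * r ≤ 1 / 2 := by
    rw [hr, ← mul_div_assoc, div_le_iff₀ (by positivity)]
    have : (2 : ℝ) * n * k ≤ 2 ^ m := by exact_mod_cast hm
    linarith
  have hr1 : r ≤ 1 / 2 := by
    have : (1 : ℝ) ≤ n := by exact_mod_cast hn
    nlinarith
  have hlow : 1 / 2 ≤ (1 - r) ^ n := by
    have := one_add_mul_le_pow (a := -r) (by linarith) n
    rw [← sub_eq_add_neg] at this
    linarith
  refine ⟨hlow, ?_⟩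
  have hprod : (1 + r) ^ n * (1 - r) ^ n ≤ 1 := by
    rw [← mul_pow]
    exact pow_le_one₀ (by nlinarith) (by nlinarith)
  have : 0 ≤ (1 + r) ^ n := by positivity
  nlinarith

/-- Above a fixed jump, block `j` is a crossing string and every other block lies in a prescribed
cell of at most `2 ^ m / k + 1` strings. -/
theorem influence_decode_le {k n m : ℕ} [NeZero k] (hm : 2 * n * k ≤ 2 ^ m)
    (G : (Fin n → ZMod k) → ℝ) (j : Fin n) (i : Fin m) :
    influence (fun u : Fin n × Fin m → Fin 2 => G (decode k u)) (j, i)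
      ≤ #(jumps G j) / (k : ℝ) ^ (n - 1) * (4 * 2 ^ (i : ℕ) / 2 ^ m) := by
  have hk : (0 : ℝ) < k := by exact_mod_cast NeZero.pos k
  set N : ℝ := 2 ^ m with hN
  have hN0 : 0 < N := by positivity
  obtain ⟨n, rfl⟩ : ∃ n', n = n' + 1 := ⟨n - 1, by have := j.pos; omega⟩
  have hfib : ∀ x : Fin (n + 1) → ZMod k,
      (#{u : Fin (n + 1) × Fin m → Fin 2 | (fun i' => u (j, i')) ∈ crossing k i (x j).val ∧
        ∀ l, l ≠ j → decode k u l = x l} : ℝ) ≤ 2 * 2 ^ (i : ℕ) * (2 * (N / k) ^ n) := by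
    intro x
    set T : Fin (n + 1) → Finset (Fin m → Fin 2) := fun l =>
      if l = j then crossing k i (x j).val else ({b | cell k b = (x l).val} : Finset (Fin m → Fin 2)) with hT
    have h1 : #{u : Fin (n + 1) × Fin m → Fin 2 | (fun i' => u (j, i')) ∈ crossing k i (x j).val ∧
        ∀ l, l ≠ j → decode k u l = x l} ≤ ∏ l, #(T l) := by
      rw [← card_blocks]
      refine card_le_card fun u hu => ?_
      simp only [mem_filter, mem_univ, true_and] at hu ⊢
      intro l
      by_cases hl : l = j
      · subst hl
        simpa [hT] using hu.1
      · simpa [hT, hl] using (decode_eq_iff u l (x l)).mp (hu.2 l hl)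
    have h2 : ((∏ l, #(T l) : ℕ) : ℝ) ≤ 2 * 2 ^ (i : ℕ) * (N / k + 1) ^ n := by
      rw [← mul_prod_erase univ _ (mem_univ j)]
      push_cast
      have hTj : (#(T j) : ℝ) ≤ 2 * 2 ^ (i : ℕ) := by
        simp only [hT, if_true]
        exact_mod_cast card_crossing_le k i (x j).val
      have hTl : ∏ l ∈ univ.erase j, (#(T l) : ℝ) ≤ (N / k + 1) ^ n := by
        calc _ ≤ ∏ l ∈ univ.erase j, (N / k + 1) := by
              refine prod_le_prod (fun _ _ => by positivity) fun l hl => ?_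
              simp only [hT, if_neg (ne_of_mem_erase hl)]
              exact (card_cell_mem_Icc k m (ZMod.val_lt (x l))).2
          _ = _ := by simp [card_erase_of_mem]
      exact mul_le_mul hTj hTl (prod_nonneg fun _ _ => by positivity) (by positivity)
    have h3 : (N / k + 1) ^ n ≤ 2 * (N / k) ^ n := by
      have hm' : 2 * n * k ≤ 2 ^ m := le_trans (by gcongr; omega) hm
      have h := (one_add_div_pow_le_two hm').2
      rw [← hN] at h
      calc (N / k + 1) ^ n = (1 + k / N) ^ n * (N / k) ^ n := by
            rw [← mul_pow]; congr 1; field_simp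
        _ ≤ _ := by gcongr
    calc _ ≤ ((∏ l, #(T l) : ℕ) : ℝ) := by exact_mod_cast h1
      _ ≤ _ := h2
      _ ≤ _ := by gcongr
  have hcard : (#(pivotal (fun u : Fin (n + 1) × Fin m → Fin 2 => G (decode k u)) (j, i)) : ℝ)
      ≤ #(jumps G j) * (2 * 2 ^ (i : ℕ) * (2 * (N / k) ^ n)) := by
    set P : (Fin (n + 1) → ZMod k) → Finset (Fin (n + 1) × Fin m → Fin 2) := fun x =>
      {u | (fun i' => u (j, i')) ∈ crossing k i (x j).val ∧ ∀ l, l ≠ j → decode k u l = x l}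
    have h1 : pivotal (fun u : Fin (n + 1) × Fin m → Fin 2 => G (decode k u)) (j, i)
        ⊆ (jumps G j).biUnion P := by
      intro u hu
      obtain ⟨x, hx, h2⟩ := exists_jump G j i hu
      exact mem_biUnion.mpr ⟨x, hx, mem_filter.mpr ⟨mem_univ u, h2⟩⟩
    calc _ ≤ ((#((jumps G j).biUnion P) : ℕ) : ℝ) := by exact_mod_cast card_le_card h1
      _ ≤ ((∑ x ∈ jumps G j, #(P x) : ℕ) : ℝ) := by exact_mod_cast card_biUnion_le
      _ = ∑ x ∈ jumps G j, (#(P x) : ℝ) := by push_cast; rfl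
      _ ≤ ∑ x ∈ jumps G j, 2 * 2 ^ (i : ℕ) * (2 * (N / k) ^ n) :=
          sum_le_sum fun x _ => hfib x
      _ = _ := by rw [sum_const, nsmul_eq_mul]
  have hpow : (2 : ℝ) ^ Fintype.card (Fin (n + 1) × Fin m) = N ^ n * N := by
    rw [Fintype.card_prod, Fintype.card_fin, Fintype.card_fin, mul_comm, pow_mul, ← hN, pow_succ]
  rw [influence, hpow, div_le_iff₀ (by positivity)]
  refine hcard.trans_eq ?_
  rw [Nat.add_sub_cancel, div_pow]
  field_simp
  ring

theorem sum_influence_decode_le {k n m : ℕ} [NeZero k] (hm : 2 * n * k ≤ 2 ^ m)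
    (G : (Fin n → ZMod k) → ℝ) :
    ∑ p, influence (fun u : Fin n × Fin m → Fin 2 => G (decode k u)) p
      ≤ 4 * ((∑ j, (#(jumps G j) : ℝ)) / (k : ℝ) ^ (n - 1)) := by
  rw [Fintype.sum_prod_type, sum_div, mul_sum]
  refine sum_le_sum fun j _ => ?_
  refine (sum_le_sum fun i _ => influence_decode_le hm G j i).trans ?_
  rw [← mul_sum, mul_comm]
  gcongr
  rw [← sum_div, ← mul_sum, div_le_iff₀ (by positivity)]
  gcongr
  rw [Fin.sum_univ_eq_sum_range (fun i => (2 : ℝ) ^ i) m, geom_sum_eq (by norm_num)]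
  norm_num

/-- Every fibre of `decode` has at least half of its fair share of strings, so averages of
nonnegative functions transfer back to the torus. -/
theorem sum_le_two_mul_sum_decode {k n m : ℕ} [NeZero k] (hm : 2 * n * k ≤ 2 ^ m)
    {h : (Fin n → ZMod k) → ℝ} (hh : ∀ x, 0 ≤ h x) :
    1 / (k : ℝ) ^ n * ∑ x, h x ≤
      2 * ((∑ u : Fin n × Fin m → Fin 2, h (decode k u)) /
        2 ^ Fintype.card (Fin n × Fin m)) := by
  have hk : (0 : ℝ) < k := by exact_mod_cast NeZero.pos k
  set N : ℝ := 2 ^ m with hN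
  have hN0 : 0 < N := by positivity
  have hpow : (2 : ℝ) ^ Fintype.card (Fin n × Fin m) = N ^ n := by
    rw [Fintype.card_prod, Fintype.card_fin, Fintype.card_fin, mul_comm, pow_mul]
  have hlow := (one_add_div_pow_le_two hm).1
  rw [← hN] at hlow
  have hfib : ∀ x : Fin n → ZMod k, (N / k) ^ n / 2 ≤
      #{u : Fin n × Fin m → Fin 2 | decode k u = x} := by
    intro x
    have h1 : #{u : Fin n × Fin m → Fin 2 | decode k u = x}
        = ∏ l, #{b : Fin m → Fin 2 | cell k b = (x l).val} := by
      rw [← card_blocks]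
      congr 1
      ext u
      simp only [mem_filter, mem_univ, true_and, funext_iff, decode_eq_iff]
    rw [h1]
    push_cast
    rcases Nat.eq_zero_or_pos n with hn | hn
    · subst hn; norm_num
    have hkN : (k : ℝ) ≤ N := by
      have : k ≤ 2 ^ m := le_trans (by nlinarith [NeZero.pos k]) hm
      rw [hN]; exact_mod_cast this
    calc (N / k) ^ n / 2 = (N / k) ^ n * (1 / 2) := by ring
      _ ≤ (N / k) ^ n * (1 - k / N) ^ n := by gcongr
      _ = ∏ l : Fin n, (N / k - 1) := by
        rw [← mul_pow, prod_const, card_univ, Fintype.card_fin]; congr 1; field_simp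
      _ ≤ _ := prod_le_prod
        (fun _ _ => by rw [sub_nonneg, le_div_iff₀ hk]; linarith)
        fun l _ => (card_cell_mem_Icc k m (ZMod.val_lt (x l))).1
  have hsum : ∑ u : Fin n × Fin m → Fin 2, h (decode k u)
      = ∑ x, (#{u : Fin n × Fin m → Fin 2 | decode k u = x} : ℝ) * h x := by
    rw [← sum_fiberwise univ (decode k)]
    refine sum_congr rfl fun x _ => ?_
    rw [← nsmul_eq_mul, ← sum_const]
    exact sum_congr rfl fun u hu => by rw [(mem_filter.mp hu).2]
  have key : (N / k) ^ n / 2 * ∑ x, h x ≤ ∑ u : Fin n × Fin m → Fin 2, h (decode k u) := by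
    rw [hsum, mul_sum]
    exact sum_le_sum fun x _ => mul_le_mul_of_nonneg_right (hfib x) (hh x)
  rw [hpow, ← mul_div_assoc, le_div_iff₀ (by positivity)]
  calc _ = 2 * ((N / k) ^ n / 2 * ∑ x, h x) := by rw [div_pow]; field_simp
    _ ≤ _ := by gcongr

/-! ### Jumps and the edge-boundary -/

/-- A non-wrapping step raises the sum of the representatives, so an edge determines the starting
point and direction of its jump. Excluding wrap-around keeps this injective even for `k = 2`. -/
theorem sum_card_jumps_le {k n : ℕ} [NeZero k] (A : Set (Fin n → ZMod k)) :
    ∑ j, #(jumps (A.indicator (1 : (Fin n → ZMod k) → ℝ)) j) ≤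
      (edgeBoundary (torus k n) A).ncard := by
  classical
  set G : (Fin n → ZMod k) → ℝ := A.indicator 1 with hG
  have hfin : (edgeBoundary (torus k n) A).Finite := Set.toFinite _
  rw [← card_sigma, Set.ncard_eq_toFinset_card _ hfin]
  have hval : ∀ (x : Fin n → ZMod k) (j : Fin n), (x j).val + 1 < k →
      (x j + 1).val = (x j).val + 1 := by
    intro x j hx
    rw [ZMod.val_add_of_lt] <;> rw [ZMod.val_one'' (by omega)]
    exact hx
  have hlt : ∀ (x : Fin n → ZMod k) (j : Fin n), (x j).val + 1 < k →
      ∑ l, (x l).val < ∑ l, (Function.update x j (x j + 1) l).val := by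
    intro x j hx
    refine sum_lt_sum (fun l _ => ?_) ⟨j, mem_univ j, by simp [hval x j hx]⟩
    by_cases hl : l = j
    · subst hl; simp [hval x l hx]
    · simp [hl]
  refine card_le_card_of_injOn
    (fun p => s(p.2, Function.update p.2 p.1 (p.2 p.1 + 1))) ?_ ?_
  · rintro ⟨j, x⟩ hp
    simp only [coe_sigma, Set.mem_sigma_iff, mem_coe, jumps, mem_filter, mem_univ, true_and] at hp
    obtain ⟨hx, hne⟩ := hp
    simp only [Set.Finite.coe_toFinset]
    refine ⟨?_, ?_⟩
    · rw [SimpleGraph.mem_edgeSet]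
      refine ⟨j, ?_, fun i hi => by simp [hi]⟩
      rw [Function.update_self, cyclicDist, add_sub_cancel_left, ZMod.valMinAbs_natAbs_eq_min,
        ZMod.val_one'' (by omega)]
      omega
    · by_cases h1 : x ∈ A <;> by_cases h2 : Function.update x j (x j + 1) ∈ A
      · simp [hG, h1, h2] at hne
      · exact ⟨x, h1, _, h2, rfl⟩
      · exact ⟨_, h2, x, h1, Sym2.eq_swap⟩
      · simp [hG, h1, h2] at hne
  · rintro ⟨j, x⟩ hp ⟨l, y⟩ hq heq
    simp only [coe_sigma, Set.mem_sigma_iff, mem_coe, jumps, mem_filter, mem_univ, true_and]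
      at hp hq
    have hx := hlt x j hp.1
    have hy := hlt y l hq.1
    simp only [Sym2.eq_iff] at heq
    rcases heq with ⟨h1, h2⟩ | ⟨h1, h2⟩
    · subst h1
      by_cases hjl : j = l
      · subst hjl; rfl
      · exfalso
        have h3 := congrFun h2 j
        rw [Function.update_self, Function.update_of_ne hjl] at h3
        have h4 := hval x j hp.1
        rw [h3] at h4
        omega
    · have h1 : x = Function.update y l (y l + 1) := h1
      have h2 : Function.update x j (x j + 1) = y := h2
      rw [h2] at hx
      rw [← h1] at hy
      omega

/-! ### Rounding to a junta and bounding its size -/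

/-- Rounding errs only when `|a - p| ≥ 1/2`. -/
theorem sq_indicator_sub_threshold {a p : ℝ} (ha : a = 0 ∨ a = 1) :
    |a - if 1 / 2 ≤ p then 1 else 0| ≤ 4 * (a - p) ^ 2 := by
  rcases ha with rfl | rfl <;> split_ifs with h
  · norm_num; nlinarith
  · norm_num; positivity
  · norm_num; positivity
  · norm_num; nlinarith

theorem decode_piecewise (k : ℕ) {n m : ℕ} (J : Finset (Fin n)) (u w : Fin n × Fin m → Fin 2) :
    decode k ((J ×ˢ (univ : Finset (Fin m))).piecewise u w) =
      J.piecewise (decode k u) (decode k w) := by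
  funext l
  by_cases hl : l ∈ J <;> simp [decode, Finset.piecewise, hl]

/-- A Boolean function on the torus whose pull-back to the cube has little Fourier weight outside
`K` is close to a junta on the blocks met by `K`. -/
theorem exists_junta_of_walshCoeff {k n m : ℕ} [NeZero k] (hm : 2 * n * k ≤ 2 ^ m)
    {f : (Fin n → ZMod k) → ℝ} (hf : ∀ x, f x = 0 ∨ f x = 1) (K : Finset (Fin n × Fin m)) {δ : ℝ}
    (hK : ∑ S with ¬ S ⊆ K, walshCoeff (fun u => f (decode k u)) S ^ 2 ≤ δ) :
    ∃ (M : ℕ) (g : (Fin n → ZMod k) → ℝ),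
      IsBooleanJunta M g ∧ IsClose (8 * δ) f g ∧ M ≤ #K := by
  set J : Finset (Fin n) := K.image Prod.fst with hJ
  set K' : Finset (Fin n × Fin m) := J ×ˢ univ with hK'
  have hKK' : K ⊆ K' := fun p hp =>
    mem_product.mpr ⟨mem_image_of_mem Prod.fst hp, mem_univ _⟩
  set F : (Fin n × Fin m → Fin 2) → ℝ := fun u => f (decode k u) with hF
  set p : (Fin n → ZMod k) → ℝ := fun x =>
    (∑ w : Fin n × Fin m → Fin 2, f (J.piecewise x (decode k w))) /
      2 ^ Fintype.card (Fin n × Fin m) with hp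
  have hpav : ∀ u, averageOff K' F u = p (decode k u) := by
    intro u
    simp only [averageOff, hF, hp]
    congr 1
    exact sum_congr rfl fun w _ => by rw [hK', decode_piecewise]
  set g : (Fin n → ZMod k) → ℝ := fun x => if 1 / 2 ≤ p x then 1 else 0 with hg
  refine ⟨#J, g, ⟨fun x => ?_, J, rfl, ?_⟩, ?_, card_image_le⟩
  · simp only [hg]
    split_ifs <;> simp
  · intro x y hxy
    have : ∀ w : Fin n → ZMod k, J.piecewise x w = J.piecewise y w := fun w =>
      J.piecewise_congr (fun i hi => hxy i hi) fun _ _ => rfl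
    simp only [hg, hp, this]
  · rw [IsClose, l1Norm]
    -- The loss `8` is `2` from the fibres times `4` from rounding.
    refine (sum_le_two_mul_sum_decode hm fun x => abs_nonneg _).trans ?_
    have hbound : ∑ u : Fin n × Fin m → Fin 2, |(f - g) (decode k u)| ≤
        4 * ∑ u, (F u - averageOff K' F u) ^ 2 := by
      rw [mul_sum]
      refine sum_le_sum fun u _ => ?_
      rw [hpav]
      exact sq_indicator_sub_threshold (hf _)
    rw [sum_sq_sub_averageOff] at hbound
    have hmono : ∑ S with ¬ S ⊆ K', walshCoeff F S ^ 2 ≤ δ := by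
      refine le_trans (sum_le_sum_of_subset_of_nonneg ?_ fun _ _ _ => sq_nonneg _) hK
      intro S hS
      exact mem_filter.mpr ⟨mem_univ S, fun h => (mem_filter.mp hS).2 (h.trans hKK')⟩
    have hle : (∑ u : Fin n × Fin m → Fin 2, |(f - g) (decode k u)|) /
        2 ^ Fintype.card (Fin n × Fin m) ≤ 4 * δ := by
      rw [div_le_iff₀ (by positivity)]
      refine hbound.trans ?_
      have : (0 : ℝ) < 2 ^ Fintype.card (Fin n × Fin m) := by positivity
      nlinarith
    linarith

theorem junta_size_le_exp {X ε : ℝ} (hε : 0 < ε) (hε1 : ε ≤ 1) (hx : ε / 8 < X) {d : ℕ}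
    (hd : (d : ℝ) ≤ 16 * (X / ε)) :
    (4 * X) ^ 3 * 9 ^ d / (4 * (ε / 8) ^ 2) ≤ Real.exp (107 * (X / ε)) := by
  set x := X / ε with hxdef
  have hx8 : 1 / 8 < x := by rw [hxdef, lt_div_iff₀ hε]; linarith
  have hX : X = x * ε := by rw [hxdef]; field_simp
  have e1 : x ≤ Real.exp x := by linarith [Real.add_one_le_exp x]
  have h3 : (9 : ℝ) ≤ Real.exp 3 := by
    have := Real.exp_one_gt_d9
    have h : Real.exp 3 = Real.exp 1 ^ 3 := by rw [← Real.exp_nat_mul]; norm_num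
    rw [h]
    calc (9 : ℝ) ≤ 2.7 ^ 3 := by norm_num
      _ ≤ _ := by gcongr; linarith
  -- Here `x > 1/8` is essential: it turns a constant into an exponential in `x`.
  have e2 : (1024 : ℝ) ≤ Real.exp (56 * x) := by
    have h : Real.exp 7 = Real.exp 1 ^ 7 := by rw [← Real.exp_nat_mul]; norm_num
    have := Real.exp_one_gt_d9
    calc (1024 : ℝ) ≤ 2.7 ^ 7 := by norm_num
      _ ≤ Real.exp 1 ^ 7 := by gcongr; linarith
      _ = Real.exp 7 := h.symm
      _ ≤ _ := Real.exp_le_exp.mpr (by linarith)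
  have e3 : (9 : ℝ) ^ d ≤ Real.exp (48 * x) := by
    calc (9 : ℝ) ^ d ≤ Real.exp 3 ^ d := by gcongr
      _ = Real.exp (d * 3) := (Real.exp_nat_mul 3 d).symm
      _ ≤ _ := Real.exp_le_exp.mpr (by linarith)
  have hx0 : 0 < x := by linarith
  calc (4 * X) ^ 3 * 9 ^ d / (4 * (ε / 8) ^ 2) = 1024 * x ^ 3 * 9 ^ d * ε := by
        rw [hX]; field_simp; ring
    _ ≤ 1024 * x ^ 3 * 9 ^ d * 1 := by gcongr
    _ ≤ Real.exp (56 * x) * Real.exp x ^ 3 * Real.exp (48 * x) * 1 := by gcongr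
    _ = _ := by
        rw [← Real.exp_nat_mul, ← Real.exp_add, ← Real.exp_add, mul_one]
        congr 1
        push_cast
        ring

end TorusJunta

/-! ### The theorem on the torus -/

theorem corollary1p5 :
    ∃ C₁ : ℝ, 0 < C₁ ∧
      ∀ (k n : ℕ) [NeZero k] (A : Set (Fin n → ZMod k)) (ε : ℝ), 0 < ε →
        ∃ (M : ℕ) (g : (Fin n → ZMod k) → ℝ),
          TorusJunta.IsBooleanJunta M g ∧
          TorusJunta.IsClose ε (A.indicator 1) g ∧
          (M : ℝ) ≤ Real.exp (C₁ * ((TorusJunta.edgeBoundary (TorusJunta.torus k n) A).ncard : ℝ) /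
            ((k : ℝ) ^ ((n : ℤ) - 1) * ε)) := by
  -- `107 = 56 + 3 + 48`, the exponents in `junta_size_le_exp`.
  refine ⟨107, by norm_num, fun k n _ A ε hε => ?_⟩
  have hk : (0 : ℝ) < k := by exact_mod_cast NeZero.pos k
  set f : (Fin n → ZMod k) → ℝ := A.indicator 1 with hf
  have hbool : ∀ x, f x = 0 ∨ f x = 1 := fun x => by
    by_cases h : x ∈ A <;> simp [hf, h]
  -- For `n = 0` the exponent is `-1`, and `f` is itself a `0`-junta; otherwise truncated `n - 1` is
  -- the true exponent.
  rcases Nat.eq_zero_or_pos n with hn | hn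
  · subst hn
    refine ⟨0, f, ⟨hbool, ∅, rfl, fun x y _ => by rw [Subsingleton.elim x y]⟩, ?_, ?_⟩
    · simpa [TorusJunta.IsClose, TorusJunta.l1Norm] using hε.le
    · simpa using (Real.exp_pos _).le
  have hzpow : (k : ℝ) ^ ((n : ℤ) - 1) = (k : ℝ) ^ (n - 1) := by
    rw [← zpow_natCast, Nat.cast_sub hn, Nat.cast_one]
  set X : ℝ := ((TorusJunta.edgeBoundary (TorusJunta.torus k n) A).ncard : ℝ) /
    (k : ℝ) ^ (n - 1) with hX
  have hX0 : 0 ≤ X := by positivity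
  have hexp : 107 * ((TorusJunta.edgeBoundary (TorusJunta.torus k n) A).ncard : ℝ) /
      ((k : ℝ) ^ ((n : ℤ) - 1) * ε) = 107 * (X / ε) := by
    rw [hzpow, hX]; field_simp
  rw [hexp]
  rcases le_or_gt 1 ε with hε1 | hε1
  · refine ⟨0, 0, ⟨fun x => Or.inl rfl, ∅, rfl, fun x y _ => rfl⟩, ?_, ?_⟩
    · rw [TorusJunta.IsClose, TorusJunta.l1Norm, sub_zero]
      refine le_trans ?_ hε1
      rw [one_div, inv_mul_le_iff₀ (by positivity), mul_one]
      calc ∑ x, |f x| ≤ ∑ _x : Fin n → ZMod k, (1 : ℝ) :=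
            Finset.sum_le_sum fun x _ => by rcases hbool x with h | h <;> simp [h]
        _ = _ := by simp [ZMod.card]
    · simpa using (Real.exp_pos _).le
  obtain ⟨m, hm⟩ : ∃ m : ℕ, 2 * n * k ≤ 2 ^ m := ⟨2 * n * k, Nat.lt_two_pow_self.le⟩
  have hI : ∑ p, TorusJunta.influence
      (fun u : Fin n × Fin m → Fin 2 => f (TorusJunta.decode k u)) p ≤ 4 * X := by
    refine (TorusJunta.sum_influence_decode_le hm f).trans ?_
    rw [hX]
    gcongr
    exact_mod_cast TorusJunta.sum_card_jumps_le A
  -- For small `X`, Poincaré's inequality already gives a constant function; otherwise `X / ε` is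
  -- bounded below, as the size estimate requires.
  rcases le_or_gt X (ε / 8) with hXε | hXε
  · obtain ⟨M, g, hg, hclose, hM⟩ := TorusJunta.exists_junta_of_walshCoeff hm hbool ∅
      (δ := ε / 8) ((TorusJunta.sum_not_subset_empty_walshCoeff_sq_le
        fun u => hbool (TorusJunta.decode k u)).trans (by linarith))
    refine ⟨M, g, hg, by rwa [mul_div_cancel₀ _ (by norm_num)] at hclose, ?_⟩
    have hM0 : M = 0 := by simpa using hM
    rw [hM0]
    simpa using (Real.exp_pos _).le
  -- The degree cutoff `d = ⌊16 X / ε⌋` makes the high-degree weight at most half of `δ = ε / 8`.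
  · have hd : 4 * X ≤ 2 * (ε / 8) * (⌊16 * (X / ε)⌋₊ + 1) := by
      have h := (Nat.lt_floor_add_one (16 * (X / ε))).le
      calc 4 * X = 2 * (ε / 8) * (16 * (X / ε)) := by field_simp; ring
        _ ≤ _ := by gcongr
    obtain ⟨K, hKcard, hK⟩ := TorusJunta.exists_junta_walshCoeff
      (fun u => hbool (TorusJunta.decode k u)) (by linarith : 0 < 4 * X)
      (by positivity : 0 < ε / 8) _ hI hd
    obtain ⟨M, g, hg, hclose, hM⟩ := TorusJunta.exists_junta_of_walshCoeff hm hbool K hK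
    refine ⟨M, g, hg, by rwa [mul_div_cancel₀ _ (by norm_num)] at hclose, ?_⟩
    calc (M : ℝ) ≤ (K.card : ℝ) := by exact_mod_cast hM
      _ ≤ _ := hKcard
      _ ≤ _ := TorusJunta.junta_size_le_exp hε hε1.le hXε (Nat.floor_le (by positivity))
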